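/- Let $Y>0$, let $\mathbf{X}$ be any set (the information space), let $\mathbf{Y}=[-Y,Y]$ be the observation space and $\mathbb{R}$ the prediction space. In the on-line prediction protocol, on each round $n=1,2,\dots$ Reality announces $x_n\in\mathbf{X}$, Predictor announces $\mu_n\in\mathbb{R}$, and Reality announces $y_n\in\mathbf{Y}$. Let $\mathbf{S}:=\bigcup_{n=1}^\infty(\mathbf{X}\times\mathbf{Y})^{n-1}\times\mathbf{X}$ be the set of situations, and write $s_n:=(x_1,y_1,\dots,x_{n-1},y_{n-1},x_n)\in\mathbf{S}$; a prediction strategy (i.e., a strategy for Predictor) is a function $\mathbf{S}\to\mathbb{R}$. Let $\mathcal{F}$ be a real Banach space of prediction strategies, with the pointwise operations of addition and multiplication by scalars, whose embedding constant $$c_{\mathcal{F}}:=\sup_{s\in\mathbf{S}}\ \sup_{F\in\mathcal{F}:\|F\|_{\mathcal{F}}\le1}|F(s)|$$ is finite, and suppose that for some $p\in[2,\infty)$ $$\delta_{\mathcal{F}}(\epsilon)\ge(\epsilon/2)^p/p\qquad\text{for all }\epsilon\in(0,2],$$ where $$\delta_{\mathcal{F}}(\epsilon):=\inf\left\{1-\left\|\frac{u+v}{2}\right\|_{\mathcal{F}}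 : u,v\in\mathcal{F},\ \|u\|_{\mathcal{F}}=\|v\|_{\mathcal{F}}=1,\ \|u-v\|_{\mathcal{F}}=\epsilon\right\}$$ is the modulus of convexity of $\mathcal{F}$ (with $\inf\emptyset:=+\infty$). Then there exists a strategy for Predictor whose predictions $\mu_n$ satisfy, whatever moves $x_1,y_1,x_2,y_2,\dots$ Reality makes, $$\left|\sum_{n=1}^N(y_n-\mu_n)^2+\sum_{n=1}^N(\mu_n-\phi_n)^2-\sum_{n=1}^N(y_n-\phi_n)^2\right|\le 40Y\sqrt{c_{\mathcal{F}}^2+1}\,\bigl(\|F\|_{\mathcal{F}}+Y\bigr)N^{1-1/p}$$ for all $N\in\{1,2,\dots\}$ and all $F\in\mathcal{F}$, where $\phi_n:=F(s_n)$ are $F$'s predictions. -/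

import Mathlib

open scoped ENNReal

/-- The situation space for information space `X` and observation space `O`: a situation
`(x₁, y₁, …, xₙ₋₁, yₙ₋₁, xₙ)` consists of a finite (possibly empty) sequence of past pairs
`(xᵢ, yᵢ)`, in chronological order, and the current side information. The first component is
the number of completed rounds. -/
abbrev Situation (X O : Type*) : Type _ :=
  Σ n : ℕ, (Fin n → X × O) × X

/-- A prediction strategy (a strategy for Predictor) with prediction space `ℝ`. -/
abbrev PredictionStrategy (X O : Type*) : Type _ :=
  Situation X O → ℝ

/-- The situation in which the prediction for the observation `y n` is made, when Reality's moves
are `x 0, y 0, x 1, y 1, …` (rounds are numbered from `0`). -/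
def situationAt {X O : Type*} (x : ℕ → X) (y : ℕ → O) (n : ℕ) : Situation X O :=
  ⟨n, (fun i : Fin n => (x i, y i)), x n⟩

/-- The modulus of convexity
`δ_U(ε) = inf {1 - ‖(u + v) / 2‖ : ‖u‖ = ‖v‖ = 1, ‖u - v‖ = ε}`.
It is an extended real, so that the infimum of the empty set is `+∞`. -/
noncomputable def modulusOfConvexity (U : Type*) [NormedAddCommGroup U] [NormedSpace ℝ U]
    (ε : ℝ) : EReal :=
  ⨅ (u : U) (v : U) (_ : ‖u‖ = 1) (_ : ‖v‖ = 1) (_ : ‖u - v‖ = ε),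
    ((1 - ‖(1 / 2 : ℝ) • (u + v)‖ : ℝ) : EReal)

/-- The embedding constant `sup_s sup_{‖F‖ ≤ 1} |F(s)|`, with values in `[0, ∞]`, of a normed
space `E` whose elements `F` are regarded as the real functions `ι F` on `S`. -/
noncomputable def embeddingConstant {S E : Type*} [NormedAddCommGroup E] [NormedSpace ℝ E]
    (ι : E →ₗ[ℝ] (S → ℝ)) : ℝ≥0∞ :=
  ⨆ (s : S) (F : E) (_ : ‖F‖ ≤ 1), ENNReal.ofReal |ι F s|

/-- Uniform convexity of power type `p` on the unit sphere, with the constant `2 ^ (-p) / p`. -/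
def PowerConvexNorm (E : Type*) [NormedAddCommGroup E] [NormedSpace ℝ E] (p : ℝ) : Prop :=
  ∀ u v : E, ‖u‖ = 1 → ‖v‖ = 1 → (‖u - v‖ / 2) ^ p / p ≤ 1 - ‖(1 / 2 : ℝ) • (u + v)‖

theorem powerConvexNorm_of_le_modulusOfConvexity {E : Type*} [NormedAddCommGroup E]
    [NormedSpace ℝ E] {p : ℝ} (hp : 0 < p)
    (hconv : ∀ ε ∈ Set.Ioc (0 : ℝ) 2,
      (((ε / 2) ^ p / p : ℝ) : EReal) ≤ modulusOfConvexity E ε) :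
    PowerConvexNorm E p := by
  intro u v hu hv
  rcases (norm_nonneg (u - v)).eq_or_lt with h | h
  · have huv : u = v := sub_eq_zero.1 (norm_eq_zero.1 h.symm)
    subst huv
    have : (1 / 2 : ℝ) • (u + u) = u := by
      rw [← two_smul ℝ u, smul_smul]; norm_num
    rw [this, hu]
    simp [Real.zero_rpow hp.ne']
  · have h2 : ‖u - v‖ ≤ 2 := by
      have := norm_sub_le u v
      linarith
    have h3 := hconv _ ⟨h, h2⟩
    have h4 : modulusOfConvexity E ‖u - v‖ ≤ ((1 - ‖(1 / 2 : ℝ) • (u + v)‖ : ℝ) : EReal) :=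
      iInf_le_of_le u <| iInf_le_of_le v <| iInf_le_of_le hu <| iInf_le_of_le hv <|
        iInf_le_of_le rfl le_rfl
    exact EReal.coe_le_coe_iff.1 (h3.trans h4)

theorem powerConvexNorm_real {p : ℝ} (hp : 1 ≤ p) : PowerConvexNorm ℝ p := by
  intro u v hu hv
  have hp0 : 0 < p := by linarith
  have hinv : p⁻¹ ≤ 1 := inv_le_one_of_one_le₀ hp
  rw [Real.norm_eq_abs] at hu hv
  rcases eq_or_eq_neg_of_abs_eq hu with rfl | rfl <;>
    rcases eq_or_eq_neg_of_abs_eq hv with rfl | rfl <;>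
    norm_num [Real.zero_rpow hp0.ne', hinv]

theorem PowerConvexNorm.rpow_norm_sub_le {E : Type*} [NormedAddCommGroup E] [NormedSpace ℝ E]
    {p : ℝ} (h : PowerConvexNorm E p) (f : E →L[ℝ] ℝ) {x w : E} (hx : ‖x‖ = 1) (hw : ‖w‖ = 1) :
    ‖f‖ * ((‖x - w‖ / 2) ^ p / p) ≤ ‖f‖ - (f x + f w) / 2 := by
  have h1 := mul_le_mul_of_nonneg_left (h x w hx hw) (norm_nonneg f)
  have h2 := (le_abs_self _).trans (f.le_opNorm ((1 / 2 : ℝ) • (x + w)))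
  simp only [map_smul, map_add, smul_eq_mul] at h2
  linarith

theorem exists_norm_eq_one_lt_apply {E : Type*} [NormedAddCommGroup E] [NormedSpace ℝ E]
    (f : E →L[ℝ] ℝ) {r : ℝ} (hr0 : 0 ≤ r) (hr : r < ‖f‖) : ∃ x : E, ‖x‖ = 1 ∧ r < f x := by
  obtain ⟨y, hy, hfy⟩ := f.exists_lt_apply_of_lt_opNorm hr
  have hy0 : y ≠ 0 := by
    rintro rfl
    simp at hfy
    linarith
  have hpos : 0 < ‖y‖ := norm_pos_iff.2 hy0
  have key : ∀ s : ℝ, |s| = 1 → s * f y = ‖f y‖ →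
      ∃ x : E, ‖x‖ = 1 ∧ r < f x := by
    intro s hs hsy
    refine ⟨(s * ‖y‖⁻¹) • y, ?_, ?_⟩
    · rw [norm_smul, norm_mul, Real.norm_eq_abs s, hs, norm_inv, norm_norm, one_mul,
        inv_mul_cancel₀ hpos.ne']
    · rw [map_smul, smul_eq_mul, mul_right_comm, hsy]
      have h1 : 1 ≤ ‖y‖⁻¹ := (one_le_inv₀ hpos).2 hy.le
      calc r < ‖f y‖ := hfy
        _ ≤ ‖f y‖ * ‖y‖⁻¹ := le_mul_of_one_le_right (norm_nonneg _) h1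
  rcases abs_choice (f y) with h | h
  · exact key 1 (by simp) (by rw [one_mul, Real.norm_eq_abs, h])
  · exact key (-1) (by simp) (by rw [Real.norm_eq_abs, h]; ring)

/-- On a complete space with power type convexity every functional attains its norm. -/
theorem PowerConvexNorm.exists_apply_eq_norm {E : Type*} [NormedAddCommGroup E]
    [NormedSpace ℝ E] [CompleteSpace E] [Nontrivial E] {p : ℝ} (hp : 0 < p)
    (h : PowerConvexNorm E p) (f : E →L[ℝ] ℝ) : ∃ x : E, ‖x‖ = 1 ∧ f x = ‖f‖ := by
  rcases (norm_nonneg f).eq_or_lt with hf | hf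
  · obtain ⟨x, hx⟩ := exists_norm_eq E zero_le_one
    refine ⟨x, hx, ?_⟩
    rw [norm_eq_zero.1 hf.symm]; simp
  have hex : ∀ n : ℕ, ∃ x : E, ‖x‖ = 1 ∧ ‖f‖ * (1 - 1 / ((n : ℝ) + 1)) < f x := by
    intro n
    have h0 : 0 < 1 / ((n : ℝ) + 1) := by positivity
    have h1 : 1 / ((n : ℝ) + 1) ≤ 1 := by
      rw [div_le_one (by positivity)]
      linarith [(Nat.cast_nonneg n : (0 : ℝ) ≤ n)]
    refine exists_norm_eq_one_lt_apply f (mul_nonneg hf.le (by linarith)) ?_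
    nlinarith
  choose x hx1 hxf using hex
  have hlim0 := tendsto_one_div_add_atTop_nhds_zero_nat (𝕜 := ℝ)
  have hlim : Filter.Tendsto (fun n : ℕ => 2 * (p * (1 / ((n : ℝ) + 1))) ^ p⁻¹)
      Filter.atTop (nhds 0) := by
    have := ((hlim0.const_mul p).rpow_const (p := p⁻¹)
      (Or.inr (inv_pos.2 hp).le)).const_mul 2
    simpa [Real.zero_rpow (inv_pos.2 hp).ne'] using this
  have hcauchy : CauchySeq x := by
    refine cauchySeq_of_le_tendsto_0 _ (fun n m N hn hm => ?_) hlim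
    have hmono : ∀ k : ℕ, N ≤ k → 1 / ((k : ℝ) + 1) ≤ 1 / ((N : ℝ) + 1) := fun k hk =>
      one_div_le_one_div_of_le (by positivity) (by gcongr)
    have h1 := h.rpow_norm_sub_le f (hx1 n) (hx1 m)
    have h2 : ‖f‖ * ((‖x n - x m‖ / 2) ^ p / p) ≤ ‖f‖ * (1 / ((N : ℝ) + 1)) := by
      have h3 := mul_le_mul_of_nonneg_left (hmono n hn) hf.le
      have h4 := mul_le_mul_of_nonneg_left (hmono m hm) hf.le
      have h5 := hxf n
      have h6 := hxf m
      linarith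
    have h3 := (div_le_iff₀ hp).1 (le_of_mul_le_mul_left h2 hf)
    have h4 : ‖x n - x m‖ / 2 ≤ (p * (1 / ((N : ℝ) + 1))) ^ p⁻¹ := by
      rw [Real.le_rpow_inv_iff_of_pos (by positivity) (by positivity) hp]
      linarith
    rw [dist_eq_norm]
    linarith
  obtain ⟨a, ha⟩ := cauchySeq_tendsto_of_complete hcauchy
  have ha1 : ‖a‖ = 1 :=
    tendsto_nhds_unique ha.norm (by simp [hx1])
  refine ⟨a, ha1, le_antisymm ?_ ?_⟩
  · simpa [ha1] using (le_abs_self _).trans (f.le_opNorm a)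
  · have h1 : Filter.Tendsto (fun n : ℕ => ‖f‖ * (1 - 1 / ((n : ℝ) + 1)))
        Filter.atTop (nhds ‖f‖) := by
      simpa using (hlim0.const_sub 1).const_mul ‖f‖
    exact le_of_tendsto_of_tendsto' h1 ((f.continuous.tendsto a).comp ha) fun n => (hxf n).le

theorem abs_sub_one_rpow_add_le_rpow {p r : ℝ} (hp : 2 ≤ p) (hr : 0 ≤ r) :
    |r - 1| ^ p + 1 + p * (r - 1) ≤ r ^ p := by
  have hsplit : ∀ s : ℝ, 0 ≤ s → s ^ p = s * s ^ (p - 1) := by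
    intro s hs
    nth_rewrite 2 [← Real.rpow_one s]
    rw [← Real.rpow_add' hs (by linarith)]
    ring_nf
  have hB := one_add_mul_self_le_rpow_one_add (s := r - 1) (by linarith) (p := p - 1)
    (by linarith)
  rw [add_sub_cancel] at hB
  rw [hsplit _ (abs_nonneg _), hsplit r hr]
  rcases le_total 1 r with h | h
  · have hS := Real.add_rpow_le_rpow_add (a := 1) (b := r - 1) (p := p - 1) zero_le_one
      (by linarith) (by linarith)
    rw [add_sub_cancel, Real.one_rpow] at hS
    rw [abs_of_nonneg (by linarith)]
    nlinarith [mul_le_mul_of_nonneg_left hS (sub_nonneg.2 h)]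
  · have hS := Real.add_rpow_le_rpow_add (a := r) (b := 1 - r) (p := p - 1) hr
      (by linarith) (by linarith)
    rw [add_sub_cancel, Real.one_rpow] at hS
    rw [abs_of_nonpos (by linarith), neg_sub]
    nlinarith [mul_le_mul_of_nonneg_left hS (sub_nonneg.2 h)]

theorem rpow_add_le_two_rpow_mul {a b p : ℝ} (ha : 0 ≤ a) (hb : 0 ≤ b) (hp : 1 ≤ p) :
    (a + b) ^ p ≤ 2 ^ (p - 1) * (a ^ p + b ^ p) := by
  lift a to NNReal using ha
  lift b to NNReal using hb
  exact_mod_cast NNReal.rpow_add_le_mul_rpow_add_rpow a b hp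

/-- Strong convexity of the `p`-th power of the norm at a point of the unit sphere. -/
theorem PowerConvexNorm.rpow_norm_ge {E : Type*} [NormedAddCommGroup E] [NormedSpace ℝ E]
    {p : ℝ} (hp : 2 ≤ p) (h : PowerConvexNorm E p) {f : E →L[ℝ] ℝ} (hf : ‖f‖ = 1) {x : E}
    (hx : ‖x‖ = 1) (hfx : f x = 1) (z : E) :
    1 + p * (f z - 1) + (4 : ℝ) ^ (1 - p) * ‖z - x‖ ^ p ≤ ‖z‖ ^ p := by
  have hp0 : 0 < p := by linarith
  obtain ⟨w, hw, hzw⟩ : ∃ w : E, ‖w‖ = 1 ∧ z = ‖z‖ • w := by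
    by_cases hz : z = 0
    · exact ⟨x, hx, by simp [hz]⟩
    · exact ⟨‖z‖⁻¹ • z, norm_smul_inv_norm (𝕜 := ℝ) hz, by
        rw [smul_smul, mul_inv_cancel₀ (norm_ne_zero_iff.2 hz), one_smul]⟩
  generalize hr : ‖z‖ = r at hzw ⊢
  have hr0 : 0 ≤ r := hr ▸ norm_nonneg z
  subst hzw
  set d := ‖x - w‖ with hd
  have hd0 : 0 ≤ d := norm_nonneg _
  have h1 := h.rpow_norm_sub_le f hx hw
  rw [hf, hfx, one_mul, ← hd, div_le_iff₀ hp0, Real.div_rpow hd0 zero_le_two] at h1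
  have h2 := abs_sub_one_rpow_add_le_rpow hp hr0
  have hpow : ‖r • w - x‖ ^ p ≤ 2 ^ (p - 1) * (|r - 1| ^ p + r * d ^ p) := by
    have hnorm : ‖r • w - x‖ ≤ |r - 1| + min 1 r * d := by
      rcases le_total 1 r with hr1 | hr1
      · rw [min_eq_left hr1]
        calc ‖r • w - x‖ = ‖(r - 1) • w + (w - x)‖ := by congr 1; module
          _ ≤ ‖(r - 1) • w‖ + ‖w - x‖ := norm_add_le _ _
          _ = _ := by rw [norm_smul, hw, norm_sub_rev w x, Real.norm_eq_abs]; ring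
      · rw [min_eq_right hr1]
        calc ‖r • w - x‖ = ‖(r - 1) • x + r • (w - x)‖ := by congr 1; module
          _ ≤ ‖(r - 1) • x‖ + ‖r • (w - x)‖ := norm_add_le _ _
          _ = _ := by
            rw [norm_smul, norm_smul, hx, norm_sub_rev w x, Real.norm_eq_abs, Real.norm_eq_abs,
              abs_of_nonneg hr0]; ring
    have hm0 : 0 ≤ min 1 r := le_min zero_le_one hr0
    have hm : (min 1 r) ^ p ≤ r := by
      calc (min 1 r) ^ p ≤ (min 1 r) ^ (1 : ℝ) :=
            Real.rpow_le_rpow_of_exponent_ge' hm0 (min_le_left _ _) zero_le_one (by linarith)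
        _ ≤ r := by rw [Real.rpow_one]; exact min_le_right _ _
    calc ‖r • w - x‖ ^ p ≤ (|r - 1| + min 1 r * d) ^ p := by gcongr
      _ ≤ 2 ^ (p - 1) * (|r - 1| ^ p + (min 1 r * d) ^ p) :=
          rpow_add_le_two_rpow_mul (abs_nonneg _) (by positivity) (by linarith)
      _ ≤ _ := by
          rw [Real.mul_rpow hm0 hd0]
          gcongr
  set T : ℝ := 2 ^ (p - 1) with hT
  have hT1 : 1 ≤ T := Real.one_le_rpow one_le_two (by linarith)
  have h4 : (4 : ℝ) ^ (1 - p) = T⁻¹ * T⁻¹ := by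
    rw [hT, ← Real.rpow_neg zero_le_two, ← Real.mul_rpow zero_le_two zero_le_two]
    norm_num
  have h2p : (2 : ℝ) ^ p = 2 * T := by
    rw [hT, Real.rpow_sub_one two_ne_zero]; ring
  have hTi : 0 < T⁻¹ := by positivity
  have hTi1 : T⁻¹ ≤ 1 := inv_le_one_of_one_le₀ hT1
  have h5 : (4 : ℝ) ^ (1 - p) * ‖r • w - x‖ ^ p ≤ |r - 1| ^ p + T⁻¹ * (r * d ^ p) := by
    calc (4 : ℝ) ^ (1 - p) * ‖r • w - x‖ ^ p
        ≤ T⁻¹ * T⁻¹ * (T * (|r - 1| ^ p + r * d ^ p)) := by rw [h4]; gcongr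
      _ = T⁻¹ * |r - 1| ^ p + T⁻¹ * (r * d ^ p) := by field_simp
      _ ≤ _ := by
        gcongr
        exact mul_le_of_le_one_left (by positivity) hTi1
  have h6 : T⁻¹ * (r * d ^ p) ≤ p * (r * (1 - f w)) := by
    have h7 : T⁻¹ * d ^ p ≤ p * (1 - f w) := by
      rw [h2p] at h1
      have : d ^ p / (2 * T) = T⁻¹ * d ^ p / 2 := by field_simp
      linarith
    calc T⁻¹ * (r * d ^ p) = r * (T⁻¹ * d ^ p) := by ring
      _ ≤ r * (p * (1 - f w)) := by gcongr
      _ = _ := by ring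
  simp only [map_smul, smul_eq_mul]
  linarith

theorem mul_le_four_mul_rpow_div_add {p q a b : ℝ} (hpq : p.HolderConjugate q) (ha : 0 ≤ a)
    (hb : 0 ≤ b) : a * b ≤ 4 * a ^ q / q + (4 : ℝ) ^ (1 - p) * b ^ p / p := by
  have h4 : (0 : ℝ) ≤ 4 := by norm_num
  have h := Real.young_inequality_of_nonneg (a := 4 ^ (1 / q) * a) (b := 4 ^ (-(1 / q)) * b)
    (by positivity) (by positivity) hpq.symm
  rw [Real.mul_rpow (by positivity) ha, Real.mul_rpow (by positivity) hb, ← Real.rpow_mul h4,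
    ← Real.rpow_mul h4, one_div_mul_cancel hpq.symm.ne_zero, Real.rpow_one] at h
  have e1 : -(1 / q) * p = 1 - p := by
    have := hpq.div_conj_eq_sub_one
    have e : -(1 / q) * p = -(p / q) := by ring
    rw [e, this]; ring
  have e2 : (4 : ℝ) ^ (1 / q) * a * (4 ^ (-(1 / q)) * b) = a * b := by
    rw [Real.rpow_neg h4]
    have : (4 : ℝ) ^ (1 / q) ≠ 0 := by positivity
    field_simp
  rw [e1, e2] at h
  exact h

theorem PowerConvexNorm.exists_rpow_norm_add_le_of_norm_eq_one {E : Type*}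
    [NormedAddCommGroup E] [NormedSpace ℝ E] [CompleteSpace E] [Nontrivial E] {p q : ℝ}
    (hp : 2 ≤ p) (hpq : p.HolderConjugate q) (h : PowerConvexNorm E p) {f : E →L[ℝ] ℝ}
    (hf : ‖f‖ = 1) :
    ∃ x : E, ∀ v : E →L[ℝ] ℝ, ‖f + v‖ ^ q ≤ 1 + q * v x + 4 * ‖v‖ ^ q := by
  have hp0 : 0 < p := by linarith
  have hq0 := hpq.symm.pos
  obtain ⟨x, hx, hfx⟩ := h.exists_apply_eq_norm hp0 f
  refine ⟨x, fun v => ?_⟩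
  obtain ⟨e, he, hge⟩ := h.exists_apply_eq_norm hp0 (f + v)
  set w := ‖f + v‖ with hw
  have hw0 : 0 ≤ w := norm_nonneg _
  set z := w ^ (q - 1) • e with hz
  have h1 := h.rpow_norm_ge hp hf hx (hfx.trans hf) z
  have hzn : ‖z‖ ^ p = w ^ q := by
    rw [hz, norm_smul, he, mul_one, Real.norm_of_nonneg (by positivity), ← Real.rpow_mul hw0,
      hpq.symm.sub_one_mul_conj]
  have hgz : f z + v z = w ^ q := by
    have : (f + v) z = w ^ q := by
      rw [hz, map_smul, hge, smul_eq_mul]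
      nth_rewrite 2 [← Real.rpow_one w]
      rw [← Real.rpow_add' hw0 (by linarith), sub_add_cancel]
    simpa using this
  have h2 : v z ≤ v x + ‖v‖ * ‖z - x‖ := by
    have := (le_abs_self _).trans (v.le_opNorm (z - x))
    rw [map_sub] at this
    linarith
  have h3 := mul_le_four_mul_rpow_div_add hpq (norm_nonneg v) (norm_nonneg (z - x))
  have hqp : q * p = q + p := by rw [mul_comm, hpq.mul_eq_add, add_comm]
  rw [hzn] at h1
  rw [div_add_div _ _ hq0.ne' hp0.ne', le_div_iff₀ (by positivity)] at h3
  have h4 := mul_le_mul_of_nonneg_left h1 hq0.le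
  have h5 : p * q * w ^ q ≤ p * q * (f z + v x + ‖v‖ * ‖z - x‖) := by
    rw [← hgz]
    gcongr ?_ * ?_
    linarith
  have h6 : p * w ^ q ≤ p * (1 + q * v x + 4 * ‖v‖ ^ q) := by
    linear_combination h5 + h4 + h3 + (1 - w ^ q) * hqp
  exact le_of_mul_le_mul_left h6 hp0

/-- The dual norm is smooth of power type `q`, with subgradients represented in the space. -/
theorem PowerConvexNorm.exists_rpow_norm_add_le {E : Type*} [NormedAddCommGroup E]
    [NormedSpace ℝ E] [CompleteSpace E] {p q : ℝ} (hp : 2 ≤ p) (hpq : p.HolderConjugate q)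
    (h : PowerConvexNorm E p) (f : E →L[ℝ] ℝ) :
    ∃ x : E, ∀ v : E →L[ℝ] ℝ, ‖f + v‖ ^ q ≤ ‖f‖ ^ q + v x + 4 * ‖v‖ ^ q := by
  rcases (norm_nonneg f).eq_or_lt with hf | hf
  · refine ⟨0, fun v => ?_⟩
    rw [norm_eq_zero.1 hf.symm]
    have : 0 ≤ ‖v‖ ^ q := by positivity
    simp [Real.zero_rpow hpq.symm.ne_zero]
    linarith
  have : Nontrivial E := by
    by_contra hE
    rw [not_nontrivial_iff_subsingleton] at hE
    exact hf.ne' (by rw [Subsingleton.elim f 0, norm_zero])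
  set t := ‖f‖ with ht
  have hnorm : ∀ g : E →L[ℝ] ℝ, t ^ q * ‖t⁻¹ • g‖ ^ q = ‖g‖ ^ q := by
    intro g
    rw [← Real.mul_rpow hf.le (norm_nonneg _), norm_smul, norm_inv, Real.norm_of_nonneg hf.le,
      mul_inv_cancel_left₀ hf.ne']
  obtain ⟨x, hx⟩ := h.exists_rpow_norm_add_le_of_norm_eq_one hp hpq (f := t⁻¹ • f)
    (by rw [norm_smul, norm_inv, Real.norm_of_nonneg hf.le, inv_mul_cancel₀ hf.ne'])
  refine ⟨(t ^ q * q * t⁻¹) • x, fun v => ?_⟩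
  have h1 := mul_le_mul_of_nonneg_left (hx (t⁻¹ • v)) (by positivity : 0 ≤ t ^ q)
  rw [← smul_add, hnorm] at h1
  rw [map_smul, smul_eq_mul, ← hnorm v]
  simp only [smul_apply, smul_eq_mul] at h1
  linarith

theorem abs_apply_le_embeddingConstant_mul_norm {S E : Type*} [NormedAddCommGroup E]
    [NormedSpace ℝ E] (ι : E →ₗ[ℝ] (S → ℝ)) (hc : embeddingConstant ι ≠ ∞) (s : S) (F : E) :
    |ι F s| ≤ (embeddingConstant ι).toReal * ‖F‖ := by
  by_cases hF : F = 0
  · simp [hF]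
  have hpos : 0 < ‖F‖ := norm_pos_iff.2 hF
  have h1 : ENNReal.ofReal |ι (‖F‖⁻¹ • F) s| ≤ embeddingConstant ι :=
    le_iSup_of_le s <| le_iSup_of_le (‖F‖⁻¹ • F) <|
      le_iSup_of_le (norm_smul_inv_norm (𝕜 := ℝ) hF).le le_rfl
  have h2 := (ENNReal.ofReal_le_iff_le_toReal hc).1 h1
  rwa [map_smul, Pi.smul_apply, smul_eq_mul, abs_mul, abs_of_pos (inv_pos.2 hpos),
    inv_mul_le_iff₀ hpos, mul_comm] at h2

/-- The evaluation functional at `s` on a space of functions with finite embedding constant. -/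
noncomputable def evaluationFunctional {S E : Type*} [NormedAddCommGroup E] [NormedSpace ℝ E]
    (ι : E →ₗ[ℝ] (S → ℝ)) (hc : embeddingConstant ι ≠ ∞) (s : S) : E →L[ℝ] ℝ :=
  LinearMap.mkContinuous ((LinearMap.proj s).comp ι) (embeddingConstant ι).toReal
    fun F => abs_apply_le_embeddingConstant_mul_norm ι hc s F

theorem norm_evaluationFunctional_le {S E : Type*} [NormedAddCommGroup E] [NormedSpace ℝ E]
    (ι : E →ₗ[ℝ] (S → ℝ)) (hc : embeddingConstant ι ≠ ∞) (s : S) :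
    ‖evaluationFunctional ι hc s‖ ≤ (embeddingConstant ι).toReal :=
  LinearMap.mkContinuous_norm_le _ ENNReal.toReal_nonneg _

theorem evaluationFunctional_apply {S E : Type*} [NormedAddCommGroup E] [NormedSpace ℝ E]
    (ι : E →ₗ[ℝ] (S → ℝ)) (hc : embeddingConstant ι ≠ ∞) (s : S) (F : E) :
    evaluationFunctional ι hc s F = ι F s :=
  rfl

theorem exists_mem_Icc_forall_mul_sub_nonpos {g : ℝ → ℝ} (hg : Continuous g) {a b : ℝ}
    (hab : a ≤ b) : ∃ μ ∈ Set.Icc a b, ∀ y ∈ Set.Icc a b, (y - μ) * g μ ≤ 0 := by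
  by_cases hb : 0 ≤ g b
  · exact ⟨b, ⟨hab, le_rfl⟩, fun y hy =>
      mul_nonpos_of_nonpos_of_nonneg (sub_nonpos.2 hy.2) hb⟩
  by_cases ha : g a ≤ 0
  · exact ⟨a, ⟨le_rfl, hab⟩, fun y hy =>
      mul_nonpos_of_nonneg_of_nonpos (sub_nonneg.2 hy.1) ha⟩
  obtain ⟨μ, hμ, h0⟩ := intermediate_value_Icc' hab hg.continuousOn
    (show (0 : ℝ) ∈ Set.Icc (g b) (g a) from ⟨(not_le.1 hb).le, (not_le.1 ha).le⟩)
  exact ⟨μ, hμ, fun y _ => by rw [h0, mul_zero]⟩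

theorem exists_abs_add_rpow_le {p q : ℝ} (hp : 2 ≤ p) (hpq : p.HolderConjugate q) (b : ℝ) :
    ∃ a : ℝ, ∀ h : ℝ, |b + h| ^ q ≤ |b| ^ q + h * a + 4 * |h| ^ q := by
  obtain ⟨a, ha⟩ := (powerConvexNorm_real (by linarith : 1 ≤ p)).exists_rpow_norm_add_le hp hpq
    (b • ContinuousLinearMap.id ℝ ℝ)
  refine ⟨a, fun h => ?_⟩
  have := ha (h • ContinuousLinearMap.id ℝ ℝ)
  rw [← add_smul] at this
  simpa [norm_smul] using this

/-- One round of defensive forecasting: some prediction keeps the growth of the potential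
`‖A‖ ^ q + |b| ^ q` bounded, whatever the observation. -/
theorem PowerConvexNorm.exists_prediction {E : Type*} [NormedAddCommGroup E]
    [NormedSpace ℝ E] [CompleteSpace E] {p q : ℝ} (hp : 2 ≤ p) (hpq : p.HolderConjugate q)
    (h : PowerConvexNorm E p) {Y R : ℝ} (hY : 0 < Y) (hR : 1 ≤ R) (A k : E →L[ℝ] ℝ) (b : ℝ)
    (hk : ‖k‖ ≤ R) :
    ∃ μ : ℝ, ∀ y ∈ Set.Icc (-Y) Y,
      ‖A + (y - μ) • k‖ ^ q + |b + (y - μ) * μ / Y| ^ q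
        ≤ ‖A‖ ^ q + |b| ^ q + 8 * (2 * Y * R) ^ q := by
  obtain ⟨x, hx⟩ := h.exists_rpow_norm_add_le hp hpq A
  obtain ⟨a, ha⟩ := exists_abs_add_rpow_le hp hpq b
  obtain ⟨μ, hμ, hμy⟩ := exists_mem_Icc_forall_mul_sub_nonpos
    (g := fun μ => k x + μ / Y * a) (by fun_prop) (by linarith : -Y ≤ Y)
  refine ⟨μ, fun y hy => ?_⟩
  have hq0 := hpq.symm.nonneg
  have h1 := hx ((y - μ) • k)
  have h2 := ha ((y - μ) * μ / Y)
  have h3 := hμy y hy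
  have hd : |y - μ| ≤ 2 * Y := by
    rw [abs_le]
    constructor <;> linarith [hy.1, hy.2, hμ.1, hμ.2]
  have h4 : ‖(y - μ) • k‖ ^ q ≤ (2 * Y * R) ^ q := by
    rw [norm_smul, Real.norm_eq_abs]
    gcongr
  have h5 : |(y - μ) * μ / Y| ^ q ≤ (2 * Y * R) ^ q := by
    have hμY : |μ / Y| ≤ R := by
      rw [abs_div, abs_of_pos hY, div_le_iff₀ hY]
      nlinarith [abs_le.2 hμ]
    rw [mul_div_assoc, abs_mul]
    gcongr
  simp only [smul_apply, smul_eq_mul] at h1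
  have h6 : (y - μ) * μ / Y * a + (y - μ) * k x ≤ 0 := by
    calc _ = (y - μ) * (k x + μ / Y * a) := by ring
      _ ≤ 0 := h3
  linarith

/-- The state reached by an automaton that reads, in each round, the current situation and then
the observation. -/
def stateAfter {X O σ : Type*} (init : σ) (upd : σ → Situation X O → O → σ) :
    (n : ℕ) → (Fin n → X × O) → σ
  | 0, _ => init
  | n + 1, h =>
    upd (stateAfter init upd n fun i => h i.castSucc)
      ⟨n, fun i => h i.castSucc, (h (Fin.last n)).1⟩ (h (Fin.last n)).2

theorem stateAfter_situationAt_succ {X O σ : Type*} (init : σ)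
    (upd : σ → Situation X O → O → σ) (x : ℕ → X) (y : ℕ → O) (n : ℕ) :
    stateAfter init upd (n + 1) (situationAt x y (n + 1)).2.1 =
      upd (stateAfter init upd n (situationAt x y n).2.1) (situationAt x y n) (y n) :=
  rfl

/-- Defensive forecasting with the evaluation functionals `k s` as features. -/
theorem PowerConvexNorm.exists_strategy {X E : Type*} [NormedAddCommGroup E]
    [NormedSpace ℝ E] [CompleteSpace E] {p q : ℝ} (hp : 2 ≤ p) (hpq : p.HolderConjugate q)
    (h : PowerConvexNorm E p) {Y R : ℝ} (hY : 0 < Y) (hR : 1 ≤ R)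
    (k : Situation X (Set.Icc (-Y) Y) → E →L[ℝ] ℝ) (hk : ∀ s, ‖k s‖ ≤ R) :
    ∃ M : PredictionStrategy X (Set.Icc (-Y) Y),
      ∀ (x : ℕ → X) (y : ℕ → Set.Icc (-Y) Y) (N : ℕ),
        ‖∑ n ∈ Finset.range N, ((y n : ℝ) - M (situationAt x y n)) • k (situationAt x y n)‖ ^ q
          + |∑ n ∈ Finset.range N,
              ((y n : ℝ) - M (situationAt x y n)) * M (situationAt x y n) / Y| ^ q
        ≤ N * (8 * (2 * Y * R) ^ q) := by
  choose pick hpick using fun (A : E →L[ℝ] ℝ) (b : ℝ) (s : Situation X (Set.Icc (-Y) Y)) =>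
    h.exists_prediction hp hpq hY hR A (k s) b (hk s)
  let upd : (E →L[ℝ] ℝ) × ℝ → Situation X (Set.Icc (-Y) Y) → Set.Icc (-Y) Y →
      (E →L[ℝ] ℝ) × ℝ := fun st s o =>
    (st.1 + ((o : ℝ) - pick st.1 st.2 s) • k s,
      st.2 + ((o : ℝ) - pick st.1 st.2 s) * pick st.1 st.2 s / Y)
  let M : PredictionStrategy X (Set.Icc (-Y) Y) := fun s =>
    pick (stateAfter 0 upd s.1 s.2.1).1 (stateAfter 0 upd s.1 s.2.1).2 s
  refine ⟨M, fun x y N => ?_⟩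
  have hstate : ∀ n : ℕ, stateAfter 0 upd n (situationAt x y n).2.1 =
      (∑ i ∈ Finset.range n, ((y i : ℝ) - M (situationAt x y i)) • k (situationAt x y i),
        ∑ i ∈ Finset.range n,
          ((y i : ℝ) - M (situationAt x y i)) * M (situationAt x y i) / Y) := by
    intro n
    induction n with
    | zero => rfl
    | succ n ih =>
      rw [stateAfter_situationAt_succ, Finset.sum_range_succ, Finset.sum_range_succ]
      have hM : M (situationAt x y n) = pick (stateAfter 0 upd n (situationAt x y n).2.1).1
        (stateAfter 0 upd n (situationAt x y n).2.1).2 (situationAt x y n) := rfl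
      rw [ih] at hM ⊢
      simp only [upd, ← hM]
  induction N with
  | zero => simp [Real.zero_rpow hpq.symm.ne_zero]
  | succ N ih =>
    rw [Finset.sum_range_succ, Finset.sum_range_succ]
    have hM : M (situationAt x y N) = pick (stateAfter 0 upd N (situationAt x y N).2.1).1
      (stateAfter 0 upd N (situationAt x y N).2.1).2 (situationAt x y N) := rfl
    have h1 := hpick (stateAfter 0 upd N (situationAt x y N).2.1).1
      (stateAfter 0 upd N (situationAt x y N).2.1).2 (situationAt x y N) (y N) (y N).2
    rw [← hM, hstate N] at h1
    push_cast
    linarith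

/-- A Banach space of prediction strategies, with pointwise operations, is given as a Banach
space `E` with an injective linear map `ι` into the space of all prediction strategies. -/
theorem proposition3 {X : Type*} (Y : ℝ) (hY : 0 < Y)
    {E : Type*} [NormedAddCommGroup E] [NormedSpace ℝ E] [CompleteSpace E]
    (ι : E →ₗ[ℝ] PredictionStrategy X (Set.Icc (-Y) Y)) (hι : Function.Injective ι)
    (hc : embeddingConstant ι ≠ ∞)
    (p : ℝ) (hp : 2 ≤ p)
    (hconv : ∀ ε ∈ Set.Ioc (0 : ℝ) 2,
      (((ε / 2) ^ p / p : ℝ) : EReal) ≤ modulusOfConvexity E ε) :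
    ∃ M : PredictionStrategy X (Set.Icc (-Y) Y),
      ∀ (x : ℕ → X) (y : ℕ → Set.Icc (-Y) Y) (N : ℕ), 1 ≤ N → ∀ F : E,
        |∑ n ∈ Finset.range N, ((y n : ℝ) - M (situationAt x y n)) ^ 2
          + ∑ n ∈ Finset.range N, (M (situationAt x y n) - ι F (situationAt x y n)) ^ 2
          - ∑ n ∈ Finset.range N, ((y n : ℝ) - ι F (situationAt x y n)) ^ 2|
        ≤ 40 * Y * √((embeddingConstant ι).toReal ^ 2 + 1) * (‖F‖ + Y)
          * (N : ℝ) ^ (1 - 1 / p) := by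
  have hp0 : 0 < p := by linarith
  have hconvex := powerConvexNorm_of_le_modulusOfConvexity hp0 hconv
  have hpq := Real.HolderConjugate.conjExponent (by linarith : 1 < p)
  set q := Real.conjExponent p
  have hq0 : 0 < q := hpq.symm.pos
  have hq1 : 1 ≤ q := hpq.symm.lt.le
  set c := (embeddingConstant ι).toReal
  set R := √(c ^ 2 + 1)
  have hR : 1 ≤ R := Real.one_le_sqrt.2 (by nlinarith [sq_nonneg c])
  have hcR : c ≤ R := Real.le_sqrt_of_sq_le (by linarith)
  obtain ⟨M, hM⟩ := hconvex.exists_strategy hp hpq hY hR (evaluationFunctional ι hc)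
    fun s => (norm_evaluationFunctional_le ι hc s).trans hcR
  refine ⟨M, fun x y N _ F => ?_⟩
  have hpot := hM x y N
  set A := ∑ n ∈ Finset.range N,
    ((y n : ℝ) - M (situationAt x y n)) • evaluationFunctional ι hc (situationAt x y n)
    with hA
  set b := ∑ n ∈ Finset.range N,
    ((y n : ℝ) - M (situationAt x y n)) * M (situationAt x y n) / Y with hb
  set B := 8 * (2 * Y * R) * (N : ℝ) ^ (1 - 1 / p) with hB
  have hBq : N * (8 * (2 * Y * R) ^ q) ≤ B ^ q := by
    have h8 : (8 : ℝ) ≤ 8 ^ q := by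
      simpa using Real.rpow_le_rpow_of_exponent_le (by norm_num : (1 : ℝ) ≤ 8) hq1
    have hN : ((N : ℝ) ^ (1 - 1 / p)) ^ q = N := by
      rw [one_div, hpq.one_sub_inv, Real.rpow_inv_rpow (Nat.cast_nonneg N) hq0.ne']
    rw [hB, Real.mul_rpow (x := 8 * (2 * Y * R)) (by positivity) (by positivity), hN,
      Real.mul_rpow (x := 8) (by norm_num) (by positivity), mul_comm (N : ℝ)]
    gcongr
  have hB0 : 0 ≤ B := by positivity
  have hAB : ‖A‖ ≤ B := by
    have hb0 : 0 ≤ |b| ^ q := by positivity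
    exact (Real.rpow_le_rpow_iff (norm_nonneg _) hB0 hq0).1 (by linarith)
  have hbB : |b| ≤ B := by
    have hA0 : 0 ≤ ‖A‖ ^ q := by positivity
    exact (Real.rpow_le_rpow_iff (abs_nonneg _) hB0 hq0).1 (by linarith)
  have hexpr : ∑ n ∈ Finset.range N, ((y n : ℝ) - M (situationAt x y n)) ^ 2
      + ∑ n ∈ Finset.range N, (M (situationAt x y n) - ι F (situationAt x y n)) ^ 2
      - ∑ n ∈ Finset.range N, ((y n : ℝ) - ι F (situationAt x y n)) ^ 2
      = 2 * (A F - Y * b) := by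
    rw [hA, hb, sum_apply, Finset.mul_sum, ← Finset.sum_sub_distrib,
      Finset.mul_sum, ← Finset.sum_add_distrib, ← Finset.sum_sub_distrib]
    refine Finset.sum_congr rfl fun n _ => ?_
    rw [smul_apply, smul_eq_mul, evaluationFunctional_apply,
      mul_div_cancel₀ _ hY.ne']
    ring
  rw [hexpr, abs_mul, abs_two]
  have hAF : |A F| ≤ B * ‖F‖ := (A.le_opNorm F).trans (by gcongr)
  have hYb : |Y * b| ≤ Y * B := by
    rw [abs_mul, abs_of_pos hY]
    gcongr
  have hrest : 0 ≤ Y * R * (‖F‖ + Y) * (N : ℝ) ^ (1 - 1 / p) := by positivity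
  calc 2 * |A F - Y * b| ≤ 2 * (B * ‖F‖ + Y * B) := by
        linarith [abs_sub (A F) (Y * b)]
    _ = 32 * (Y * R * (‖F‖ + Y) * (N : ℝ) ^ (1 - 1 / p)) := by rw [hB]; ring
    _ ≤ 40 * (Y * R * (‖F‖ + Y) * (N : ℝ) ^ (1 - 1 / p)) := by linarith
    _ = _ := by ring
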